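/- Theorem (Abrosimov, 2010). An ideal hyperbolic tetrahedron is a (non-degenerate) tetrahedron in hyperbolic 3-space $H^3$ (of curvature $-1$) all of whose vertices lie on the sphere at infinity. For an ideal tetrahedron $T$ with faces numbered $1,2,3,4$ let $A_{ij}\in(0,\pi)$, $i\ne j$, be the interior dihedral angle between the faces $i$ and $j$, put $A_{ii}=\pi$, and let $G(T)=(-\cos A_{ij})_{i,j=1,\dots,4}$ be its Gram matrix. (Opposite dihedral angles of an ideal tetrahedron are equal, so numbering the angles by the vertices at the ends of the edge gives the same matrix.) Call $T$ acute if all its dihedral angles are less than $\pi/2$, and obtuse if at least one of them is greater than $\pi/2$. Then: (1) For every ideal tetrahedron $T$, with $A=A_{12}$ and $B=A_{13}$, $$\det G(T)=-4\sin^2A\,\sin^2B\,\sin^2(A+B).$$ (2) Let $T,T'$ be two ideal tetrahedra that are both acute or both obtuse, with $\det G(T)=\det G(T')$ and $\operatorname{per}G(T)=\operatorname{per}G(T')$. Then $T$ and $T'$ have the same dihedral angles up to a renumbering of the faces: there is a permutation $\sigma$ of $\{1,2,3,4\}$ with $A_{ij}(T')=A_{\sigma(i)\sigma(j)}(T)$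 for all $i,j$. Moreover $T$ and $T'$ have the same hyperbolic volume. In particular, within the class of acute ideal tetrahedra, and separately within the class of obtuse ones, the volume is uniquely determined by the determinant and the permanent of the Gram matrix. -/

import Mathlib

open MeasureTheory
open scoped ENNReal

noncomputable section

/-- Hyperbolic volume in the projective (Klein) model of hyperbolic 3-space: the space is the open
unit ball of Euclidean 3-space, geodesic segments and planes are the Euclidean ones, and the
metric of curvature `-1` is `⟪u, v⟫ / (1 - ‖x‖²) + ⟪x, u⟫ ⟪x, v⟫ / (1 - ‖x‖²)²`, whose Riemannian
volume element is `(1 - ‖x‖²)⁻² dx`. -/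
def hyperbolicVolume : Measure (EuclideanSpace ℝ (Fin 3)) :=
  (volume.restrict (Metric.ball 0 1)).withDensity
    (fun x => ENNReal.ofReal (1 / (1 - ‖x‖ ^ 2) ^ 2))

/-- An ideal hyperbolic tetrahedron in the Klein model: four affinely independent points on the
unit sphere, the sphere at infinity. -/
structure IdealTetrahedron extends
    Affine.Simplex ℝ (EuclideanSpace ℝ (Fin 3)) 3 where
  norm_points : ∀ i, ‖points i‖ = 1

/-- The Lorentz form on `ℝ³ × ℝ`. A plane `{x | ⟪n, x⟫ = d}` that meets the open unit ball is
represented by the space-like vector `(n, d)`. -/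
def lorentzForm (N M : EuclideanSpace ℝ (Fin 3) × ℝ) : ℝ :=
  inner ℝ N.1 M.1 - N.2 * M.2

namespace IdealTetrahedron

/-- The solid tetrahedron: the points of hyperbolic space in the convex hull of the vertices. -/
def region (T : IdealTetrahedron) : Set (EuclideanSpace ℝ (Fin 3)) :=
  convexHull ℝ (Set.range T.points) ∩ Metric.ball 0 1

/-- The hyperbolic volume of the tetrahedron. -/
def vol (T : IdealTetrahedron) : ℝ≥0∞ :=
  hyperbolicVolume T.region

/-- The outward normal `(n, d)` of the face opposite to vertex `i`, not normalized: that face lies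
in `{x | ⟪n, x⟫ = d}` and the tetrahedron in `{x | ⟪n, x⟫ ≤ d}`. Here `n` goes from vertex `i` to
its orthogonal projection to the plane of the face. -/
def faceNormal (T : IdealTetrahedron) (i : Fin 4) : EuclideanSpace ℝ (Fin 3) × ℝ :=
  let f := T.toSimplex.altitudeFoot i
  (f - T.points i, inner ℝ (f - T.points i) f)

/-- The interior dihedral angle between the faces opposite to the vertices `i` and `j`, which is
`π` minus the angle between the outward normals of the faces. It lies at the edge that joins the
other two vertices. At any point `x` of that edge the Klein metric on covectors is
`(1 - ‖x‖²) (⟪α, β⟫ - ⟪α, x⟫ ⟪β, x⟫)`, so that the Lorentz form gives the Riemannian angle there.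
For `i = j` the value is `π`. -/
def dihedralAngle (T : IdealTetrahedron) (i j : Fin 4) : ℝ :=
  Real.arccos (-(lorentzForm (T.faceNormal i) (T.faceNormal j)) /
    (Real.sqrt (lorentzForm (T.faceNormal i) (T.faceNormal i)) *
      Real.sqrt (lorentzForm (T.faceNormal j) (T.faceNormal j))))

/-- The Gram matrix of the tetrahedron. -/
def gramMatrix (T : IdealTetrahedron) : Matrix (Fin 4) (Fin 4) ℝ :=
  Matrix.of fun i j => -Real.cos (T.dihedralAngle i j)

/-- All dihedral angles are less than `π / 2`. -/
def IsAcute (T : IdealTetrahedron) : Prop :=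
  ∀ i j, i ≠ j → T.dihedralAngle i j < Real.pi / 2

/-- At least one dihedral angle is greater than `π / 2`. -/
def IsObtuse (T : IdealTetrahedron) : Prop :=
  ∃ i j, i ≠ j ∧ Real.pi / 2 < T.dihedralAngle i j

end IdealTetrahedron

end

/-!
An ideal tetrahedron is governed by the light-like vectors `pᵢ = (1, vᵢ)` over its vertices. Their
Gram matrix for the Lorentz form has zero diagonal and off-diagonal entries `-|vᵢ - vⱼ|² / 2`, and
its determinant is negative because the form has signature `(3, 1)` (`det_lightGram_neg`). The face
normals are negative multiples of the dual basis, so their Gram matrix is the inverse matrix up to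
scaling of rows and columns (`lorentzForm_faceNormal`). Inverting it explicitly, the dihedral
angles turn out to be the angles of the Euclidean triangle whose sides are the products of the
lengths of opposite edges (`dihedralAngle_eq`); negativity of the determinant is the triangle
inequality in Heron's form.

Let `u`, `v`, `w` be the cosines of the three angles. They satisfy `u² + v² + w² + 2uvw = 1`, which
turns the determinant of the Gram matrix into `-4 (1 - u²) (1 - v²) (1 - w²)` and the permanent into
`S² + 6S - 3` with `S = u² + v² + w²`. So the permanent determines `S` and `uvw = (1 - S) / 2`, and
the determinant then determines `u²v² + v²w² + w²u²`: the squares of the cosines are known up to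
order. For acute tetrahedra all cosines are positive. For obtuse ones exactly one is negative, the
one with the smallest square. Hence the angles are known up to order, and every permutation of the
three pairs of opposite edges is induced by a renumbering of the faces.

For the volume, `hyperbolicVolume_eq_volume_lorentzCone` identifies the hyperbolic volume with four
times the Lebesgue measure of the part below the unit hyperboloid of the cone over the tetrahedron
in Minkowski space. In coordinates with respect to positive multiples `sᵢ pᵢ`, this measure depends
only on the Gram matrix of these vectors (`hyperbolicVolume_eq_of_gram`). By the law of sines the
factors `sᵢ` can be chosen so that this Gram matrix is `(-sin Aᵢⱼ)` (`exists_scaling`), so the volume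
is a function of the dihedral angles that does not depend on the numbering.
-/

/-! ### Light-like vectors and face normals -/

/-- The matrix of the Lorentz form on `ℝ⁴`, with the time coordinate first. -/
def lorentzMatrix : Matrix (Fin 4) (Fin 4) ℝ :=
  Matrix.diagonal ![-1, 1, 1, 1]

/-- The vector `(t, x)` of `ℝ⁴` with time coordinate `t` and space coordinates `x`. -/
def spacetime (t : ℝ) (x : EuclideanSpace ℝ (Fin 3)) : Fin 4 → ℝ :=
  Matrix.vecCons t x

/-- The matrix whose rows are the vectors `(tᵢ, xᵢ)`. -/
def spacetimeMatrix (t : Fin 4 → ℝ) (x : Fin 4 → EuclideanSpace ℝ (Fin 3)) :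
    Matrix (Fin 4) (Fin 4) ℝ :=
  Matrix.of fun i => spacetime (t i) (x i)

lemma spacetimeMatrix_mul_lorentzMatrix_mul_transpose (t t' : Fin 4 → ℝ)
    (x x' : Fin 4 → EuclideanSpace ℝ (Fin 3)) (i j : Fin 4) :
    (spacetimeMatrix t x * lorentzMatrix * (spacetimeMatrix t' x').transpose) i j =
      inner ℝ (x i) (x' j) - t i * t' j := by
  simp [spacetimeMatrix, spacetime, lorentzMatrix, Matrix.mul_apply, Fin.sum_univ_succ,
    Matrix.diagonal_apply, PiLp.inner_apply]
  ring

lemma det_lorentzMatrix : lorentzMatrix.det = -1 := by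
  simp [lorentzMatrix, Fin.prod_univ_succ]

/-- A Gram determinant of four vectors is nonpositive: the form has signature `(3, 1)`. -/
lemma det_mul_lorentzMatrix_mul_transpose (M : Matrix (Fin 4) (Fin 4) ℝ) :
    (M * lorentzMatrix * M.transpose).det = -M.det ^ 2 := by
  rw [Matrix.det_mul, Matrix.det_mul, Matrix.det_transpose, det_lorentzMatrix]
  ring

namespace IdealTetrahedron

variable (T : IdealTetrahedron)

/-- The matrix whose rows are the light-like vectors `(1, vᵢ)` over the ideal vertices `vᵢ`. -/
def lightMatrix : Matrix (Fin 4) (Fin 4) ℝ :=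
  spacetimeMatrix (fun _ => 1) T.points

lemma det_lightMatrix_ne_zero : T.lightMatrix.det ≠ 0 := by
  intro h
  obtain ⟨w, hw, hw0⟩ := Matrix.exists_vecMul_eq_zero_iff.2 h
  have hsum : ∑ i, w i = 0 := by
    simpa [lightMatrix, spacetimeMatrix, spacetime, Matrix.vecMul, dotProduct] using
      congrFun hw0 0
  have hpts : ∑ i, w i • T.points i = 0 := by
    ext k
    simpa [lightMatrix, spacetimeMatrix, spacetime, Matrix.vecMul, dotProduct] using
      congrFun hw0 k.succ
  exact hw (funext fun i => T.independent.eq_zero_of_sum_eq_zero hsum hpts i (Finset.mem_univ i))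

/-- The Euclidean distance between two vertices. -/
noncomputable def edge (i j : Fin 4) : ℝ := dist (T.points i) (T.points j)

lemma edge_comm (i j : Fin 4) : T.edge i j = T.edge j i := dist_comm _ _

lemma edge_self (i : Fin 4) : T.edge i i = 0 := dist_self _

lemma edge_pos {i j : Fin 4} (h : i ≠ j) : 0 < T.edge i j :=
  dist_pos.2 (T.independent.injective.ne h)

lemma inner_points_sub_one (i j : Fin 4) :
    inner ℝ (T.points i) (T.points j) - 1 = -(T.edge i j ^ 2 / 2) := by
  rw [edge, dist_eq_norm, @norm_sub_sq_real, T.norm_points, T.norm_points]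
  ring

/-- The Gram matrix of the light-like vectors. -/
def lightGram : Matrix (Fin 4) (Fin 4) ℝ :=
  T.lightMatrix * lorentzMatrix * T.lightMatrix.transpose

lemma lightGram_apply (i j : Fin 4) : T.lightGram i j = -(T.edge i j ^ 2 / 2) := by
  rw [lightGram, lightMatrix, spacetimeMatrix_mul_lorentzMatrix_mul_transpose,
    ← inner_points_sub_one, one_mul]

lemma det_lightGram_neg : T.lightGram.det < 0 := by
  rw [lightGram, det_mul_lorentzMatrix_mul_transpose]
  have := T.det_lightMatrix_ne_zero
  have : 0 < T.lightMatrix.det ^ 2 := by positivity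
  linarith

/-- The matrix of the face normals. -/
noncomputable def normalMatrix : Matrix (Fin 4) (Fin 4) ℝ :=
  spacetimeMatrix (fun i => (T.faceNormal i).2) (fun i => (T.faceNormal i).1)

lemma normalMatrix_gram (i j : Fin 4) :
    (T.normalMatrix * lorentzMatrix * T.normalMatrix.transpose) i j =
      lorentzForm (T.faceNormal i) (T.faceNormal j) := by
  rw [normalMatrix, spacetimeMatrix_mul_lorentzMatrix_mul_transpose, lorentzForm]

/-- Up to negative factors, the face normals are the basis dual to the light-like vectors. -/
lemma normalMatrix_mul_lightMatrix :
    T.normalMatrix * lorentzMatrix * T.lightMatrix.transpose =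
      Matrix.diagonal fun i => -(T.height i ^ 2) := by
  ext i j
  rw [normalMatrix, lightMatrix, spacetimeMatrix_mul_lorentzMatrix_mul_transpose]
  simp only [faceNormal, mul_one, ← inner_sub_right]
  rcases eq_or_ne i j with rfl | h
  · rw [Matrix.diagonal_apply_eq, Affine.Simplex.height, dist_eq_norm,
      ← neg_sub (T.points i), inner_neg_left, real_inner_self_eq_norm_sq]
  · rw [Matrix.diagonal_apply_ne _ h, ← neg_sub (T.points i), inner_neg_left, neg_eq_zero,
      real_inner_comm]
    exact T.toSimplex.inner_vsub_altitudeFoot_vsub_altitudeFoot_eq_zero h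

/-- The Gram matrix of the face normals is the inverse of the Gram matrix of the light-like
vectors, up to scaling of rows and columns. -/
lemma lorentzForm_faceNormal (i j : Fin 4) :
    lorentzForm (T.faceNormal i) (T.faceNormal j) =
      T.height i ^ 2 * T.height j ^ 2 * T.lightGram⁻¹ i j := by
  set P := T.lightMatrix
  set N := T.normalMatrix
  set H : Matrix (Fin 4) (Fin 4) ℝ := Matrix.diagonal fun i => -(T.height i ^ 2)
  have hP : IsUnit P.det := isUnit_iff_ne_zero.2 T.det_lightMatrix_ne_zero
  have hD : IsUnit T.lightGram.det := isUnit_iff_ne_zero.2 T.det_lightGram_neg.ne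
  have h1 : N * lorentzMatrix * P.transpose = H := T.normalMatrix_mul_lightMatrix
  have hJ : lorentzMatrix.transpose = lorentzMatrix := by simp [lorentzMatrix]
  have h2 : P * lorentzMatrix * N.transpose = H := by
    have := congrArg Matrix.transpose h1
    simpa [Matrix.transpose_mul, hJ, Matrix.mul_assoc, H] using this
  -- expand the normals in the basis of light-like vectors
  have h3 : N = H * T.lightGram⁻¹ * P := by
    have hPt : IsUnit (lorentzMatrix * P.transpose).det := by
      rw [Matrix.det_mul, Matrix.det_transpose, det_lorentzMatrix]
      exact (isUnit_one.neg).mul hP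
    have : N * (lorentzMatrix * P.transpose) =
        H * T.lightGram⁻¹ * P * (lorentzMatrix * P.transpose) := by
      rw [← Matrix.mul_assoc, h1, Matrix.mul_assoc (H * _), ← Matrix.mul_assoc P]
      change H = H * T.lightGram⁻¹ * T.lightGram
      rw [Matrix.mul_assoc, Matrix.nonsing_inv_mul _ hD, Matrix.mul_one]
    exact Matrix.mul_left_injective_of_inv _ _ (Matrix.mul_nonsing_inv _ hPt) this
  rw [← normalMatrix_gram]
  change (N * lorentzMatrix * N.transpose) i j = _
  have h4 : N * lorentzMatrix * N.transpose = H * T.lightGram⁻¹ * H := by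
    nth_rewrite 1 [h3]
    rw [Matrix.mul_assoc, Matrix.mul_assoc _ P, ← Matrix.mul_assoc P, h2]
  rw [h4, Matrix.mul_diagonal, Matrix.diagonal_mul]
  ring

end IdealTetrahedron

/-! ### Dihedral angles as angles of a Euclidean triangle -/

/-- Sixteen times the squared area of the triangle with sides `a`, `b`, `c` (Heron's formula). -/
def heron (a b c : ℝ) : ℝ :=
  2 * (a ^ 2 * b ^ 2 + b ^ 2 * c ^ 2 + c ^ 2 * a ^ 2) - (a ^ 4 + b ^ 4 + c ^ 4)

/-- The cosine of the angle opposite to the side `a` in the triangle with sides `a`, `b`, `c`. -/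
noncomputable def cosRule (a b c : ℝ) : ℝ :=
  (b ^ 2 + c ^ 2 - a ^ 2) / (2 * b * c)

/-- The angles of a tetrahedron in which opposite edges have equal angles `α`, `β`, `γ`, with the
convention that the diagonal is `π`. -/
noncomputable def angleMatrix (α β γ : ℝ) : Matrix (Fin 4) (Fin 4) ℝ :=
  !![Real.pi, α, β, γ; α, Real.pi, γ, β; β, γ, Real.pi, α; γ, β, α, Real.pi]

/-- The adjugate of the symmetric matrix with zero diagonal and the given entries above the
diagonal, written out. -/
def zeroDiagAdjugate (p q r w t s : ℝ) : Matrix (Fin 4) (Fin 4) ℝ :=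
  let x := p * s
  let y := q * t
  let z := r * w
  !![2 * w * t * s, s * (x - y - z), t * (y - z - x), w * (z - x - y);
     s * (x - y - z), 2 * q * r * s, r * (z - x - y), q * (y - z - x);
     t * (y - z - x), r * (z - x - y), 2 * p * r * t, p * (x - y - z);
     w * (z - x - y), q * (y - z - x), p * (x - y - z), 2 * p * q * w]

lemma zeroDiag_mul_adjugate (p q r w t s : ℝ) :
    !![0, p, q, r; p, 0, w, t; q, w, 0, s; r, t, s, 0] * zeroDiagAdjugate p q r w t s =
      ((p * s) ^ 2 + (q * t) ^ 2 + (r * w) ^ 2 -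
        2 * (p * s * (q * t) + q * t * (r * w) + r * w * (p * s))) •
          (1 : Matrix (Fin 4) (Fin 4) ℝ) := by
  ext i j
  fin_cases i <;> fin_cases j <;>
    simp [zeroDiagAdjugate, Matrix.mul_apply, Fin.sum_univ_succ] <;> ring

lemma det_zeroDiag (p q r w t s : ℝ) :
    !![0, p, q, r; p, 0, w, t; q, w, 0, s; r, t, s, 0].det =
      (p * s) ^ 2 + (q * t) ^ 2 + (r * w) ^ 2 -
        2 * (p * s * (q * t) + q * t * (r * w) + r * w * (p * s)) := by
  simp [Matrix.det_succ_row_zero, Fin.sum_univ_succ, Fin.succAbove]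
  ring

namespace IdealTetrahedron

variable (T : IdealTetrahedron)

/-- The product of the lengths of the edges `01` and `23`. -/
noncomputable def sideA : ℝ := T.edge 0 1 * T.edge 2 3

/-- The product of the lengths of the edges `02` and `13`. -/
noncomputable def sideB : ℝ := T.edge 0 2 * T.edge 1 3

/-- The product of the lengths of the edges `03` and `12`. -/
noncomputable def sideC : ℝ := T.edge 0 3 * T.edge 1 2

lemma sideA_pos : 0 < T.sideA := mul_pos (T.edge_pos (by decide)) (T.edge_pos (by decide))

lemma sideB_pos : 0 < T.sideB := mul_pos (T.edge_pos (by decide)) (T.edge_pos (by decide))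

lemma sideC_pos : 0 < T.sideC := mul_pos (T.edge_pos (by decide)) (T.edge_pos (by decide))

lemma lightGram_eq :
    T.lightGram = (-1 / 2 : ℝ) •
      !![0, T.edge 0 1 ^ 2, T.edge 0 2 ^ 2, T.edge 0 3 ^ 2;
         T.edge 0 1 ^ 2, 0, T.edge 1 2 ^ 2, T.edge 1 3 ^ 2;
         T.edge 0 2 ^ 2, T.edge 1 2 ^ 2, 0, T.edge 2 3 ^ 2;
         T.edge 0 3 ^ 2, T.edge 1 3 ^ 2, T.edge 2 3 ^ 2, 0] := by
  ext i j
  rw [lightGram_apply]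
  fin_cases i <;> fin_cases j <;>
    simp [T.edge_self, T.edge_comm 1 0, T.edge_comm 2 0, T.edge_comm 3 0, T.edge_comm 2 1,
      T.edge_comm 3 1, T.edge_comm 3 2] <;> ring

lemma heron_pos : 0 < heron T.sideA T.sideB T.sideC := by
  have h := T.det_lightGram_neg
  rw [lightGram_eq, Matrix.det_smul, det_zeroDiag] at h
  norm_num at h
  unfold heron sideA sideB sideC
  nlinarith [h]

/-- The adjugate of the matrix of squared edge lengths. -/
noncomputable def edgeAdjugate : Matrix (Fin 4) (Fin 4) ℝ :=
  zeroDiagAdjugate (T.edge 0 1 ^ 2) (T.edge 0 2 ^ 2) (T.edge 0 3 ^ 2) (T.edge 1 2 ^ 2)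
    (T.edge 1 3 ^ 2) (T.edge 2 3 ^ 2)

lemma lightGram_inv :
    T.lightGram⁻¹ = (2 / heron T.sideA T.sideB T.sideC) • T.edgeAdjugate := by
  have hh := T.heron_pos
  apply Matrix.inv_eq_right_inv
  rw [lightGram_eq, edgeAdjugate, Matrix.smul_mul, Matrix.mul_smul, zeroDiag_mul_adjugate,
    smul_smul, smul_smul]
  convert one_smul ℝ (1 : Matrix (Fin 4) (Fin 4) ℝ)
  have : heron T.sideA T.sideB T.sideC ≠ 0 := hh.ne'
  field_simp
  unfold heron sideA sideB sideC
  ring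

lemma dihedralAngle_eq_arccos (i j : Fin 4) :
    T.dihedralAngle i j = Real.arccos (-T.edgeAdjugate i j /
      (Real.sqrt (T.edgeAdjugate i i) * Real.sqrt (T.edgeAdjugate j j))) := by
  have hi := T.height_pos i
  have hj := T.height_pos j
  have hk : 0 < 2 / heron T.sideA T.sideB T.sideC := div_pos two_pos T.heron_pos
  rw [dihedralAngle]
  simp only [lorentzForm_faceNormal, lightGram_inv, Matrix.smul_apply, smul_eq_mul]
  set k := 2 / heron T.sideA T.sideB T.sideC
  have key : ∀ h x : ℝ, 0 < h → Real.sqrt (h ^ 2 * h ^ 2 * (k * x)) =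
      h ^ 2 * Real.sqrt k * Real.sqrt x := by
    intro h x hh
    rw [Real.sqrt_mul (by positivity), Real.sqrt_mul hk.le, Real.sqrt_mul_self (by positivity)]
    ring
  rw [key _ _ hi, key _ _ hj]
  congr 1
  have hs : Real.sqrt k * Real.sqrt k = k := Real.mul_self_sqrt hk.le
  have e1 : T.height i ^ 2 * Real.sqrt k * Real.sqrt (T.edgeAdjugate i i) *
      (T.height j ^ 2 * Real.sqrt k * Real.sqrt (T.edgeAdjugate j j)) =
      (T.height i ^ 2 * T.height j ^ 2 * k) *
        (Real.sqrt (T.edgeAdjugate i i) * Real.sqrt (T.edgeAdjugate j j)) := by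
    linear_combination (T.height i ^ 2 * Real.sqrt (T.edgeAdjugate i i) *
      (T.height j ^ 2 * Real.sqrt (T.edgeAdjugate j j))) * hs
  rw [e1, show -(T.height i ^ 2 * T.height j ^ 2 * (k * T.edgeAdjugate i j)) =
    (T.height i ^ 2 * T.height j ^ 2 * k) * -T.edgeAdjugate i j by ring]
  exact mul_div_mul_left _ _ (by positivity)

/-- The dihedral angles are the angles of the Euclidean triangle whose sides are the products of
the lengths of opposite edges. -/
lemma dihedralAngle_eq (i j : Fin 4) :
    T.dihedralAngle i j =
      angleMatrix (Real.arccos (cosRule T.sideA T.sideB T.sideC))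
        (Real.arccos (cosRule T.sideB T.sideC T.sideA))
        (Real.arccos (cosRule T.sideC T.sideA T.sideB)) i j := by
  have h01 := T.edge_pos (i := 0) (j := 1) (by decide)
  have h02 := T.edge_pos (i := 0) (j := 2) (by decide)
  have h03 := T.edge_pos (i := 0) (j := 3) (by decide)
  have h12 := T.edge_pos (i := 1) (j := 2) (by decide)
  have h13 := T.edge_pos (i := 1) (j := 3) (by decide)
  have h23 := T.edge_pos (i := 2) (j := 3) (by decide)
  have key : ∀ x y z : ℝ, 0 < x → 0 < y → 0 < z → Real.sqrt (2 * x ^ 2 * y ^ 2 * z ^ 2) =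
      Real.sqrt 2 * (x * y * z) := by
    intro x y z hx hy hz
    rw [show 2 * x ^ 2 * y ^ 2 * z ^ 2 = 2 * (x * y * z) ^ 2 by ring, Real.sqrt_mul two_pos.le,
      Real.sqrt_sq (by positivity)]
  have h2 : Real.sqrt 2 ^ 2 = 2 := Real.sq_sqrt two_pos.le
  rw [dihedralAngle_eq_arccos]
  fin_cases i <;> fin_cases j <;>
      simp only [angleMatrix, edgeAdjugate, zeroDiagAdjugate, Matrix.of_apply, Matrix.cons_val',
        Matrix.cons_val, Fin.zero_eta, Fin.mk_one, Fin.reduceFinMk, Matrix.cons_val_zero, Matrix.cons_val_one] <;>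
      simp only [key _ _ _ h01 h02 h12, key _ _ _ h01 h03 h13, key _ _ _ h02 h03 h23,
        key _ _ _ h12 h13 h23] <;>
      first
      | (rw [← Real.arccos_neg_one]
         congr 1
         field_simp
         rw [h2]
         try ring)
      | (congr 1
         simp only [cosRule, sideA, sideB, sideC]
         field_simp
         rw [h2]
         try ring)

end IdealTetrahedron

/-! ### Trigonometry of the triangle -/

lemma heron_rotate (a b c : ℝ) : heron b c a = heron a b c := by
  unfold heron; ring

section Triangle

variable {a b c : ℝ}

lemma one_sub_cosRule_sq (hb : 0 < b) (hc : 0 < c) :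
    1 - cosRule a b c ^ 2 = heron a b c / (2 * b * c) ^ 2 := by
  unfold cosRule heron
  field_simp
  ring

lemma cosRule_sq_lt_one (hb : 0 < b) (hc : 0 < c) (h : 0 < heron a b c) :
    cosRule a b c ^ 2 < 1 := by
  have := one_sub_cosRule_sq (a := a) hb hc
  have : 0 < heron a b c / (2 * b * c) ^ 2 := by positivity
  linarith

lemma cos_arccos_cosRule (hb : 0 < b) (hc : 0 < c) (h : 0 < heron a b c) :
    Real.cos (Real.arccos (cosRule a b c)) = cosRule a b c := by
  have := abs_lt.1 ((sq_lt_one_iff_abs_lt_one _).1 (cosRule_sq_lt_one hb hc h))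
  exact Real.cos_arccos this.1.le this.2.le

/-- The law of sines. -/
lemma sin_arccos_cosRule (ha : 0 < a) (hb : 0 < b) (hc : 0 < c) :
    Real.sin (Real.arccos (cosRule a b c)) =
      a * (Real.sqrt (heron a b c) / (2 * a * b * c)) := by
  rw [Real.sin_arccos, one_sub_cosRule_sq hb hc, Real.sqrt_div' _ (by positivity),
    Real.sqrt_sq (by positivity)]
  field_simp

lemma cosRule_relation (ha : 0 < a) (hb : 0 < b) (hc : 0 < c) :
    cosRule a b c ^ 2 + cosRule b c a ^ 2 + cosRule c a b ^ 2 +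
      2 * cosRule a b c * cosRule b c a * cosRule c a b = 1 := by
  unfold cosRule
  field_simp
  ring

lemma cosRule_add_mul (ha : 0 < a) (hb : 0 < b) (hc : 0 < c) :
    cosRule a b c + cosRule b c a * cosRule c a b = heron a b c / (4 * a ^ 2 * b * c) := by
  unfold cosRule heron
  field_simp
  ring

end Triangle

/-- The cosines of the angles of a non-degenerate Euclidean triangle, characterized
algebraically. -/
structure IsTriangleCosines (u v w : ℝ) : Prop where
  sq_lt₁ : u ^ 2 < 1
  sq_lt₂ : v ^ 2 < 1
  sq_lt₃ : w ^ 2 < 1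
  relation : u ^ 2 + v ^ 2 + w ^ 2 + 2 * u * v * w = 1
  add_mul_pos₁ : 0 < u + v * w
  add_mul_pos₂ : 0 < v + w * u
  add_mul_pos₃ : 0 < w + u * v

lemma isTriangleCosines_cosRule {a b c : ℝ} (ha : 0 < a) (hb : 0 < b) (hc : 0 < c)
    (h : 0 < heron a b c) :
    IsTriangleCosines (cosRule a b c) (cosRule b c a) (cosRule c a b) := by
  have h1 : 0 < heron b c a := by rwa [heron_rotate]
  have h2 : 0 < heron c a b := by rwa [heron_rotate]
  refine ⟨cosRule_sq_lt_one hb hc h, cosRule_sq_lt_one hc ha h1, cosRule_sq_lt_one ha hb h2,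
    cosRule_relation ha hb hc, ?_, ?_, ?_⟩
  · rw [cosRule_add_mul ha hb hc]; positivity
  · rw [cosRule_add_mul hb hc ha]; positivity
  · rw [cosRule_add_mul hc ha hb]; positivity

/-- The symmetric matrix with unit diagonal in which opposite pairs of indices carry the same
entry `-u`, `-v` or `-w`. -/
def cosineMatrix (u v w : ℝ) : Matrix (Fin 4) (Fin 4) ℝ :=
  !![1, -u, -v, -w; -u, 1, -w, -v; -v, -w, 1, -u; -w, -v, -u, 1]

lemma det_cosineMatrix (u v w : ℝ) :
    (cosineMatrix u v w).det =
      1 + u ^ 4 + v ^ 4 + w ^ 4 - 2 * (u ^ 2 + v ^ 2 + w ^ 2) -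
        2 * (u ^ 2 * v ^ 2 + v ^ 2 * w ^ 2 + w ^ 2 * u ^ 2) - 8 * u * v * w := by
  simp [cosineMatrix, Matrix.det_succ_row_zero, Fin.sum_univ_succ, Fin.succAbove]
  ring

/-- Laplace expansion of the permanent along the first column. The remaining rows of each minor
come in the order in which the transposition of `0` and `i` puts them. -/
lemma permanent_succ_column_zero {n : ℕ} (M : Matrix (Fin (n + 1)) (Fin (n + 1)) ℝ) :
    M.permanent = ∑ i, M i 0 *
      (M.submatrix (fun r : Fin n => Equiv.swap 0 i r.succ) Fin.succ).permanent := by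
  simp only [Matrix.permanent]
  rw [← Equiv.sum_comp Equiv.Perm.decomposeFin.symm, Fintype.sum_prod_type]
  simp [Fin.prod_univ_succ, Finset.mul_sum]

lemma permanent_fin_two (M : Matrix (Fin 2) (Fin 2) ℝ) :
    M.permanent = M 0 0 * M 1 1 + M 1 0 * M 0 1 := by
  have h0 : (fun r : Fin 1 => Equiv.swap (0 : Fin 2) 0 r.succ) = ![1] := by decide
  have h1 : (fun r : Fin 1 => Equiv.swap (0 : Fin 2) 1 r.succ) = ![0] := by decide
  rw [permanent_succ_column_zero, Fin.sum_univ_two, h0, h1, Matrix.permanent_unique,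
    Matrix.permanent_unique]
  simp

lemma permanent_fin_three (M : Matrix (Fin 3) (Fin 3) ℝ) :
    M.permanent = M 0 0 * (M 1 1 * M 2 2 + M 1 2 * M 2 1) +
      M 1 0 * (M 0 1 * M 2 2 + M 0 2 * M 2 1) + M 2 0 * (M 1 1 * M 0 2 + M 1 2 * M 0 1) := by
  have h0 : (fun r : Fin 2 => Equiv.swap (0 : Fin 3) 0 r.succ) = ![1, 2] := by decide
  have h1 : (fun r : Fin 2 => Equiv.swap (0 : Fin 3) 1 r.succ) = ![0, 2] := by decide
  have h2 : (fun r : Fin 2 => Equiv.swap (0 : Fin 3) 2 r.succ) = ![1, 0] := by decide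
  rw [permanent_succ_column_zero, Fin.sum_univ_three, h0, h1, h2]
  simp only [permanent_fin_two]
  simp
  ring

lemma permanent_cosineMatrix (u v w : ℝ) :
    (cosineMatrix u v w).permanent =
      1 + u ^ 4 + v ^ 4 + w ^ 4 + 2 * (u ^ 2 + v ^ 2 + w ^ 2) +
        2 * (u ^ 2 * v ^ 2 + v ^ 2 * w ^ 2 + w ^ 2 * u ^ 2) - 8 * u * v * w := by
  have h0 : (fun r : Fin 3 => Equiv.swap (0 : Fin 4) 0 r.succ) = ![1, 2, 3] := by decide
  have h1 : (fun r : Fin 3 => Equiv.swap (0 : Fin 4) 1 r.succ) = ![0, 2, 3] := by decide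
  have h2 : (fun r : Fin 3 => Equiv.swap (0 : Fin 4) 2 r.succ) = ![1, 0, 3] := by decide
  have h3 : (fun r : Fin 3 => Equiv.swap (0 : Fin 4) 3 r.succ) = ![1, 2, 0] := by decide
  rw [permanent_succ_column_zero, Fin.sum_univ_four, h0, h1, h2, h3]
  simp only [permanent_fin_three]
  simp [cosineMatrix]
  ring

lemma IsTriangleCosines.det_eq {u v w : ℝ} (h : IsTriangleCosines u v w) :
    (cosineMatrix u v w).det = -4 * (1 - u ^ 2) * (1 - v ^ 2) * (1 - w ^ 2) := by
  rw [det_cosineMatrix]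
  have := h.relation
  linear_combination (u ^ 2 + v ^ 2 + w ^ 2 - 2 * u * v * w - 5) * this

/-! ### Recovering the angles from the determinant and the permanent -/

namespace IsTriangleCosines

variable {u v w u' v' w' : ℝ}

lemma rotate (h : IsTriangleCosines u v w) : IsTriangleCosines v w u where
  sq_lt₁ := h.sq_lt₂
  sq_lt₂ := h.sq_lt₃
  sq_lt₃ := h.sq_lt₁
  relation := by linear_combination h.relation
  add_mul_pos₁ := h.add_mul_pos₂
  add_mul_pos₂ := h.add_mul_pos₃
  add_mul_pos₃ := h.add_mul_pos₁

lemma swap (h : IsTriangleCosines u v w) : IsTriangleCosines u w v where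
  sq_lt₁ := h.sq_lt₁
  sq_lt₂ := h.sq_lt₃
  sq_lt₃ := h.sq_lt₂
  relation := by linear_combination h.relation
  add_mul_pos₁ := by linarith [h.add_mul_pos₁, mul_comm v w]
  add_mul_pos₂ := by linarith [h.add_mul_pos₃, mul_comm u v]
  add_mul_pos₃ := by linarith [h.add_mul_pos₂, mul_comm u w]

/-- In a triangle at most one angle is obtuse, and its cosine is the smallest in absolute value:
the side opposite to the obtuse angle is the longest one, so its angle has the largest sine. -/
lemma lt_of_neg (h : IsTriangleCosines u v w) (hu : u < 0) : -u < v ∧ -u < w := by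
  have hu1 := (abs_lt.1 ((sq_lt_one_iff_abs_lt_one _).1 h.sq_lt₁)).1
  have hv1 := (abs_lt.1 ((sq_lt_one_iff_abs_lt_one _).1 h.sq_lt₂)).2
  have hw1 := (abs_lt.1 ((sq_lt_one_iff_abs_lt_one _).1 h.sq_lt₃)).2
  have h1 := h.add_mul_pos₁
  have h2 := h.add_mul_pos₂
  have h3 := h.add_mul_pos₃
  have hv : 0 < v := by
    by_contra hv
    -- `v > -u w` and `w > -u v` with `0 < -u < 1` would force `v > u² v`
    nlinarith [mul_pos (neg_pos.2 hu) h3, h.sq_lt₁]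
  have hw : 0 < w := by nlinarith
  constructor <;> nlinarith

lemma eq_of_sq_eq_of_neg (h : IsTriangleCosines u v w) (h' : IsTriangleCosines u' v' w')
    (hu : u ^ 2 = u' ^ 2) (hv : v ^ 2 = v' ^ 2) (hw : w ^ 2 = w' ^ 2) (hneg : u < 0)
    (hneg' : u' < 0 ∨ v' < 0 ∨ w' < 0) : u = u' ∧ v = v' ∧ w = w' := by
  obtain ⟨hv0, hw0⟩ := h.lt_of_neg hneg
  have hu' : u' < 0 := by
    rcases hneg' with hn | hn | hn
    · exact hn
    · have := (h'.rotate.lt_of_neg hn).2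
      nlinarith
    · have := (h'.rotate.rotate.lt_of_neg hn).1
      nlinarith
  obtain ⟨hv0', hw0'⟩ := h'.lt_of_neg hu'
  refine ⟨?_, ?_, ?_⟩
  · have := (sq_eq_sq₀ (neg_pos.2 hneg).le (neg_pos.2 hu').le).1 (by linarith [neg_sq u, neg_sq u'])
    linarith
  · exact (sq_eq_sq₀ (by linarith) (by linarith)).1 hv
  · exact (sq_eq_sq₀ (by linarith) (by linarith)).1 hw

lemma eq_of_sq_eq (h : IsTriangleCosines u v w) (h' : IsTriangleCosines u' v' w')
    (hu : u ^ 2 = u' ^ 2) (hv : v ^ 2 = v' ^ 2) (hw : w ^ 2 = w' ^ 2)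
    (hc : ((0 < u ∧ 0 < v ∧ 0 < w) ∧ (0 < u' ∧ 0 < v' ∧ 0 < w')) ∨
      ((u < 0 ∨ v < 0 ∨ w < 0) ∧ (u' < 0 ∨ v' < 0 ∨ w' < 0))) :
    u = u' ∧ v = v' ∧ w = w' := by
  rcases hc with ⟨⟨h1, h2, h3⟩, h1', h2', h3'⟩ | ⟨hn, hn'⟩
  · exact ⟨(sq_eq_sq₀ h1.le h1'.le).1 hu, (sq_eq_sq₀ h2.le h2'.le).1 hv,
      (sq_eq_sq₀ h3.le h3'.le).1 hw⟩
  · rcases hn with hn | hn | hn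
    · exact h.eq_of_sq_eq_of_neg h' hu hv hw hn hn'
    · have := h.rotate.eq_of_sq_eq_of_neg h'.rotate hv hw hu hn (by tauto)
      tauto
    · have := h.rotate.rotate.eq_of_sq_eq_of_neg h'.rotate.rotate hw hu hv hn (by tauto)
      tauto

/-- The permanent is an increasing function of `u² + v² + w²`, which also determines `uvw`; the
determinant then yields `u²v² + v²w² + w²u²`. Hence the elementary symmetric functions of the
squares agree. -/
lemma symmetric_eq (h : IsTriangleCosines u v w) (h' : IsTriangleCosines u' v' w')
    (hdet : (cosineMatrix u v w).det = (cosineMatrix u' v' w').det)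
    (hper : (cosineMatrix u v w).permanent = (cosineMatrix u' v' w').permanent) :
    u ^ 2 + v ^ 2 + w ^ 2 = u' ^ 2 + v' ^ 2 + w' ^ 2 ∧
    u ^ 2 * v ^ 2 + v ^ 2 * w ^ 2 + w ^ 2 * u ^ 2 =
      u' ^ 2 * v' ^ 2 + v' ^ 2 * w' ^ 2 + w' ^ 2 * u' ^ 2 ∧
    u * v * w = u' * v' * w' := by
  have key : ∀ {x y z : ℝ}, IsTriangleCosines x y z → (cosineMatrix x y z).permanent =
      (x ^ 2 + y ^ 2 + z ^ 2) ^ 2 + 6 * (x ^ 2 + y ^ 2 + z ^ 2) - 3 := by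
    intro x y z hx
    rw [permanent_cosineMatrix]
    linear_combination -4 * hx.relation
  have hS : u ^ 2 + v ^ 2 + w ^ 2 = u' ^ 2 + v' ^ 2 + w' ^ 2 := by
    rw [key h, key h'] at hper
    have : (u ^ 2 + v ^ 2 + w ^ 2 - (u' ^ 2 + v' ^ 2 + w' ^ 2)) *
        (u ^ 2 + v ^ 2 + w ^ 2 + (u' ^ 2 + v' ^ 2 + w' ^ 2) + 6) = 0 := by
      linear_combination hper
    rcases mul_eq_zero.1 this with h0 | h0
    · linarith
    · nlinarith [sq_nonneg u, sq_nonneg v, sq_nonneg w, sq_nonneg u', sq_nonneg v', sq_nonneg w']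
  have hm : u * v * w = u' * v' * w' := by
    linear_combination (h.relation - h'.relation - hS) / 2
  refine ⟨hS, ?_, hm⟩
  rw [det_cosineMatrix, det_cosineMatrix] at hdet
  linear_combination (-hdet + (u ^ 2 + v ^ 2 + w ^ 2 + u' ^ 2 + v' ^ 2 + w' ^ 2 - 2) * hS
    - 8 * hm) / 4

/-- Three numbers are determined up to order by their elementary symmetric functions. -/
lemma perm_of_symmetric_eq {x y z x' y' z' : ℝ} (h1 : x + y + z = x' + y' + z')
    (h2 : x * y + y * z + z * x = x' * y' + y' * z' + z' * x') (h3 : x * y * z = x' * y' * z') :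
    (x' = x ∧ y' = y ∧ z' = z) ∨ (x' = x ∧ y' = z ∧ z' = y) ∨ (x' = y ∧ y' = x ∧ z' = z) ∨
    (x' = y ∧ y' = z ∧ z' = x) ∨ (x' = z ∧ y' = x ∧ z' = y) ∨ (x' = z ∧ y' = y ∧ z' = x) := by
  -- a pair is determined up to order by its sum and product
  have pair : ∀ {p q r s : ℝ}, p + q = r + s → p * q = r * s →
      (p = r ∧ q = s) ∨ (p = s ∧ q = r) := by
    intro p q r s hs hp
    have : (p - r) * (p - s) = 0 := by linear_combination p * hs - hp
    rcases mul_eq_zero.1 this with h | h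
    · left; constructor <;> linarith
    · right; constructor <;> linarith
  have hx : (x' - x) * ((x' - y) * (x' - z)) = 0 := by
    linear_combination -x' ^ 2 * h1 + x' * h2 - h3
  rcases mul_eq_zero.1 hx with h | h
  · obtain rfl : x' = x := by linarith
    have := pair (p := y') (q := z') (r := y) (s := z) (by linarith)
      (by linear_combination -h2 + x' * h1)
    tauto
  · rcases mul_eq_zero.1 h with h | h
    · obtain rfl : x' = y := by linarith
      have := pair (p := y') (q := z') (r := x) (s := z) (by linarith)
        (by linear_combination -h2 + x' * h1)
      tauto
    · obtain rfl : x' = z := by linarith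
      have := pair (p := y') (q := z') (r := x) (s := y) (by linarith)
        (by linear_combination -h2 + x' * h1)
      tauto

/-- Within the acute and within the obtuse class, the cosines are determined up to order by the
determinant and the permanent. -/
lemma perm_of_det_eq_of_permanent_eq (h : IsTriangleCosines u v w)
    (h' : IsTriangleCosines u' v' w')
    (hc : ((0 < u ∧ 0 < v ∧ 0 < w) ∧ (0 < u' ∧ 0 < v' ∧ 0 < w')) ∨
      ((u < 0 ∨ v < 0 ∨ w < 0) ∧ (u' < 0 ∨ v' < 0 ∨ w' < 0)))
    (hdet : (cosineMatrix u v w).det = (cosineMatrix u' v' w').det)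
    (hper : (cosineMatrix u v w).permanent = (cosineMatrix u' v' w').permanent) :
    (u' = u ∧ v' = v ∧ w' = w) ∨ (u' = u ∧ v' = w ∧ w' = v) ∨ (u' = v ∧ v' = u ∧ w' = w) ∨
    (u' = v ∧ v' = w ∧ w' = u) ∨ (u' = w ∧ v' = u ∧ w' = v) ∨ (u' = w ∧ v' = v ∧ w' = u) := by
  obtain ⟨h1, h2, h3⟩ := h.symmetric_eq h' hdet hper
  have h3' : u ^ 2 * v ^ 2 * w ^ 2 = u' ^ 2 * v' ^ 2 * w' ^ 2 := by
    linear_combination (u * v * w + u' * v' * w') * h3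
  have hc' : ∀ x y z : ℝ, ((0 < u ∧ 0 < v ∧ 0 < w) → 0 < x ∧ 0 < y ∧ 0 < z) →
      ((u < 0 ∨ v < 0 ∨ w < 0) → x < 0 ∨ y < 0 ∨ z < 0) →
      ((0 < u' ∧ 0 < v' ∧ 0 < w') ∧ (0 < x ∧ 0 < y ∧ 0 < z)) ∨
        ((u' < 0 ∨ v' < 0 ∨ w' < 0) ∧ (x < 0 ∨ y < 0 ∨ z < 0)) := fun x y z hp hn =>
    hc.imp (fun k => ⟨k.2, hp k.1⟩) (fun k => ⟨k.2, hn k.1⟩)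
  rcases perm_of_symmetric_eq h1 h2 h3' with ⟨hu, hv, hw⟩ | ⟨hu, hv, hw⟩ | ⟨hu, hv, hw⟩ |
    ⟨hu, hv, hw⟩ | ⟨hu, hv, hw⟩ | ⟨hu, hv, hw⟩
  · exact .inl (h'.eq_of_sq_eq h hu hv hw (hc' _ _ _ id id))
  · exact .inr (.inl (h'.eq_of_sq_eq h.swap hu hv hw
      (hc' _ _ _ (by tauto) (by tauto))))
  · exact .inr (.inr (.inl (h'.eq_of_sq_eq h.rotate.swap hu hv hw
      (hc' _ _ _ (by tauto) (by tauto)))))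
  · exact .inr (.inr (.inr (.inl (h'.eq_of_sq_eq h.rotate hu hv hw
      (hc' _ _ _ (by tauto) (by tauto))))))
  · exact .inr (.inr (.inr (.inr (.inl (h'.eq_of_sq_eq h.rotate.rotate hu hv hw
      (hc' _ _ _ (by tauto) (by tauto)))))))
  · exact .inr (.inr (.inr (.inr (.inr (h'.eq_of_sq_eq h.rotate.rotate.swap hu hv hw
      (hc' _ _ _ (by tauto) (by tauto)))))))

end IsTriangleCosines

/-! ### Hyperbolic volume as a Lebesgue measure in Minkowski space -/

/-- For a subset `S` of the Klein ball, the part of the cone over `S × {1}` in Minkowski space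
that lies below the unit hyperboloid. -/
def lorentzCone (S : Set (EuclideanSpace ℝ (Fin 3))) : Set (ℝ × EuclideanSpace ℝ (Fin 3)) :=
  {y | 0 < y.1 ∧ y.1⁻¹ • y.2 ∈ S ∧ y.1 ^ 2 - ‖y.2‖ ^ 2 ≤ 1}

lemma measurableSet_lorentzCone {S : Set (EuclideanSpace ℝ (Fin 3))} (hS : MeasurableSet S) :
    MeasurableSet (lorentzCone S) := by
  have h1 : MeasurableSet {y : ℝ × EuclideanSpace ℝ (Fin 3) | 0 < y.1} :=
    measurableSet_lt measurable_const measurable_fst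
  have h2 : Measurable fun y : ℝ × EuclideanSpace ℝ (Fin 3) => y.1⁻¹ • y.2 :=
    measurable_fst.inv.smul measurable_snd
  have h3 : MeasurableSet {y : ℝ × EuclideanSpace ℝ (Fin 3) | y.1 ^ 2 - ‖y.2‖ ^ 2 ≤ 1} :=
    measurableSet_le (by fun_prop) measurable_const
  exact h1.inter ((h2 hS).inter h3)

open scoped Pointwise in
lemma volume_lorentzCone_slice (S : Set (EuclideanSpace ℝ (Fin 3))) {t : ℝ} (ht : 0 < t) :
    volume (Prod.mk t ⁻¹' lorentzCone S) =
      ENNReal.ofReal (t ^ 3) * volume (S ∩ {x | t ^ 2 * (1 - ‖x‖ ^ 2) ≤ 1}) := by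
  have : Prod.mk t ⁻¹' lorentzCone S = t • (S ∩ {x | t ^ 2 * (1 - ‖x‖ ^ 2) ≤ 1}) := by
    ext X
    rw [Set.mem_smul_set_iff_inv_smul_mem₀ ht.ne']
    simp only [lorentzCone, Set.mem_preimage, Set.mem_ofPred_eq, ht, true_and, Set.mem_inter_iff]
    refine and_congr_right fun _ => ?_
    rw [norm_smul, norm_inv, Real.norm_of_nonneg ht.le]
    have : t ^ 2 * (1 - (t⁻¹ * ‖X‖) ^ 2) = t ^ 2 - ‖X‖ ^ 2 := by field_simp
    rw [this]
  rw [this, Measure.addHaar_smul, finrank_euclideanSpace_fin, abs_of_pos (by positivity)]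

lemma lintegral_Ioc_ofReal_pow_three {r : ℝ} (hr : 0 ≤ r) :
    ∫⁻ t in Set.Ioc 0 r, ENNReal.ofReal (t ^ 3) = ENNReal.ofReal (r ^ 4 / 4) := by
  rw [← ofReal_integral_eq_lintegral_ofReal, ← intervalIntegral.integral_of_le hr, integral_pow]
  · norm_num
  · exact (intervalIntegral.intervalIntegrable_pow 3).1
  · filter_upwards [ae_restrict_mem measurableSet_Ioc] with t ht
    exact pow_nonneg ht.1.le 3

/-- The hyperbolic volume of `S` is four times the Lebesgue measure of the cone over `S` below the
unit hyperboloid: over `x ∈ S` the cone reaches up to the height `(1 - ‖x‖²)^(-1/2)`, and the slice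
at height `t` is scaled by `t³`. -/
lemma hyperbolicVolume_eq_volume_lorentzCone {S : Set (EuclideanSpace ℝ (Fin 3))}
    (hS : MeasurableSet S) (hball : S ⊆ Metric.ball 0 1) :
    hyperbolicVolume S = 4 * volume (lorentzCone S) := by
  have hrS : (volume.restrict (Metric.ball (0 : EuclideanSpace ℝ (Fin 3)) 1)).restrict S =
      volume.restrict S := by
    rw [Measure.restrict_restrict hS, Set.inter_eq_left.2 hball]
  rw [hyperbolicVolume, withDensity_apply _ hS, hrS]
  let A : Set (ℝ × EuclideanSpace ℝ (Fin 3)) :=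
    {y | 0 < y.1 ∧ y.1 ^ 2 * (1 - ‖y.2‖ ^ 2) ≤ 1}
  have hA : MeasurableSet A := by
    have h : Measurable fun y : ℝ × EuclideanSpace ℝ (Fin 3) => y.1 ^ 2 * (1 - ‖y.2‖ ^ 2) := by
      fun_prop
    exact (measurableSet_lt measurable_const measurable_fst).inter
      (measurableSet_le h measurable_const)
  let g : ℝ × EuclideanSpace ℝ (Fin 3) → ℝ≥0∞ := A.indicator fun y => ENNReal.ofReal (y.1 ^ 3)
  have hg : Measurable g := by
    refine Measurable.indicator ?_ hA
    fun_prop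
  have h1 : volume (lorentzCone S) = ∫⁻ t : ℝ, ∫⁻ x in S, g (t, x) := by
    rw [Measure.volume_eq_prod, Measure.prod_apply (measurableSet_lorentzCone hS)]
    refine lintegral_congr fun t => ?_
    rcases le_or_gt t 0 with ht | ht
    · have e : Prod.mk t ⁻¹' lorentzCone S = ∅ := by
        ext X
        simp [lorentzCone, ht.not_gt]
      have e' : ∀ x, g (t, x) = 0 := fun x => Set.indicator_of_notMem (fun h => ht.not_gt h.1) _
      simp [e, e']
    · have hm : MeasurableSet {x : EuclideanSpace ℝ (Fin 3) | t ^ 2 * (1 - ‖x‖ ^ 2) ≤ 1} :=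
        measurableSet_le (by fun_prop) measurable_const
      have e' : ∀ x, g (t, x) = {x : EuclideanSpace ℝ (Fin 3) |
          t ^ 2 * (1 - ‖x‖ ^ 2) ≤ 1}.indicator (fun _ => ENNReal.ofReal (t ^ 3)) x := by
        intro x
        simp [g, A, Set.indicator_apply, ht]
      rw [volume_lorentzCone_slice S ht]
      simp_rw [e']
      rw [lintegral_indicator_const hm, Measure.restrict_apply hm, Set.inter_comm]
  rw [h1, lintegral_lintegral_swap (by exact hg.aemeasurable),
    ← lintegral_const_mul' _ _ (by norm_num)]
  refine setLIntegral_congr_fun hS fun x hx => ?_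
  have hx1 : ‖x‖ < 1 := by simpa using hball hx
  have hpos : 0 < 1 - ‖x‖ ^ 2 := by nlinarith [norm_nonneg x]
  have e : ∀ t, g (t, x) = (Set.Ioc 0 (Real.sqrt (1 - ‖x‖ ^ 2))⁻¹).indicator
      (fun t => ENNReal.ofReal (t ^ 3)) t := by
    intro t
    have : (t, x) ∈ A ↔ t ∈ Set.Ioc 0 (Real.sqrt (1 - ‖x‖ ^ 2))⁻¹ := by
      simp only [A, Set.mem_ofPred_eq, Set.mem_Ioc]
      refine and_congr_right fun ht => ?_
      rw [← Real.sqrt_inv, Real.le_sqrt ht.le (by positivity), ← one_div, le_div_iff₀ hpos]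
    by_cases h : (t, x) ∈ A
    · rw [Set.indicator_of_mem (this.1 h)]
      exact Set.indicator_of_mem h _
    · rw [Set.indicator_of_notMem (fun h' => h (this.2 h'))]
      exact Set.indicator_of_notMem h _
  simp_rw [e]
  rw [lintegral_indicator measurableSet_Ioc, lintegral_Ioc_ofReal_pow_three (by positivity)]
  rw [show (4 : ℝ≥0∞) = ENNReal.ofReal 4 by simp, ← ENNReal.ofReal_mul (by norm_num)]
  congr 1
  rw [inv_pow, show Real.sqrt (1 - ‖x‖ ^ 2) ^ 4 = (Real.sqrt (1 - ‖x‖ ^ 2) ^ 2) ^ 2 by ring,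
    Real.sq_sqrt hpos.le]
  field_simp

/-! ### The volume in terms of the Gram matrix of the light-like vectors -/

lemma mem_convexHull_range_iff {v : Fin 4 → EuclideanSpace ℝ (Fin 3)}
    {x : EuclideanSpace ℝ (Fin 3)} :
    x ∈ convexHull ℝ (Set.range v) ↔
      ∃ w : Fin 4 → ℝ, (∀ i, 0 ≤ w i) ∧ ∑ i, w i = 1 ∧ ∑ i, w i • v i = x := by
  constructor
  · intro hx
    have h : Set.range v = Fintype.linearCombination ℝ v ''
        (Set.range fun i j : Fin 4 => if i = j then (1 : ℝ) else 0) := by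
      rw [← Set.range_comp]
      congr 1
      ext i : 1
      simp [Fintype.linearCombination_apply]
    rw [h, ← LinearMap.image_convexHull, convexHull_basis_eq_stdSimplex] at hx
    obtain ⟨w, hw, rfl⟩ := hx
    exact ⟨w, hw.1, hw.2, rfl⟩
  · rintro ⟨w, h0, h1, rfl⟩
    exact (convex_convexHull ℝ _).sum_mem (fun i _ => h0 i) h1
      fun i _ => subset_convexHull ℝ _ (Set.mem_range_self i)

/-- The vectors with nonnegative coordinates that are time-like of length at most one for the
Lorentz form with Gram matrix `K`. -/
def gramCone (K : Matrix (Fin 4) (Fin 4) ℝ) : Set (Fin 4 → ℝ) :=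
  {c | (∀ i, 0 ≤ c i) ∧ 0 < -(c ⬝ᵥ K.mulVec c) ∧ -(c ⬝ᵥ K.mulVec c) ≤ 1}

/-- Splitting off the time coordinate of a vector of Minkowski space. -/
def splitTime (y : Fin 4 → ℝ) : ℝ × EuclideanSpace ℝ (Fin 3) :=
  (y 0, WithLp.toLp 2 fun i => y i.succ)

lemma measurePreserving_splitTime : MeasurePreserving splitTime := by
  have h1 := volume_preserving_piFinSuccAbove (fun _ : Fin 4 => ℝ) 0
  have h2 := (MeasurePreserving.id (volume : Measure ℝ)).prod (PiLp.volume_preserving_toLp (Fin 3))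
  exact h2.comp h1

lemma splitTime_vecMul (s : Fin 4 → ℝ) (v : Fin 4 → EuclideanSpace ℝ (Fin 3)) (c : Fin 4 → ℝ) :
    splitTime (Matrix.vecMul c (spacetimeMatrix s fun i => s i • v i)) =
      (∑ i, c i * s i, ∑ i, (c i * s i) • v i) := by
  refine Prod.ext ?_ ?_
  · simp [splitTime, spacetimeMatrix, spacetime, Matrix.vecMul, dotProduct]
  · ext k
    simp [splitTime, spacetimeMatrix, spacetime, Matrix.vecMul, dotProduct, mul_assoc]

lemma dotProduct_gram_mulVec (s : Fin 4 → ℝ) (x : Fin 4 → EuclideanSpace ℝ (Fin 3))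
    (c : Fin 4 → ℝ) :
    c ⬝ᵥ (spacetimeMatrix s x * lorentzMatrix * (spacetimeMatrix s x).transpose).mulVec c =
      ‖∑ i, c i • x i‖ ^ 2 - (∑ i, c i * s i) ^ 2 := by
  simp only [dotProduct, Matrix.mulVec, spacetimeMatrix_mul_lorentzMatrix_mul_transpose]
  rw [← real_inner_self_eq_norm_sq, sum_inner, sq, Finset.sum_mul, ← Finset.sum_sub_distrib]
  refine Finset.sum_congr rfl fun i _ => ?_
  rw [inner_sum, Finset.mul_sum, Finset.mul_sum, ← Finset.sum_sub_distrib]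
  refine Finset.sum_congr rfl fun j _ => ?_
  rw [real_inner_smul_left, real_inner_smul_right]
  ring

/-- In the coordinates with respect to positive multiples of the light-like vectors `(1, vᵢ)`, the
cone over the tetrahedron is cut out of the positive orthant by their Gram matrix. -/
lemma preimage_splitTime_lorentzCone {s : Fin 4 → ℝ} (hs : ∀ i, 0 < s i)
    {v : Fin 4 → EuclideanSpace ℝ (Fin 3)} {M : Matrix (Fin 4) (Fin 4) ℝ}
    (hM : M = spacetimeMatrix s fun i => s i • v i) (hdet : M.det ≠ 0) :
    splitTime ⁻¹' lorentzCone (convexHull ℝ (Set.range v) ∩ Metric.ball 0 1) =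
      Matrix.toLin' M.transpose '' gramCone (M * lorentzMatrix * M.transpose) := by
  have hlin : ∀ c, Matrix.toLin' M.transpose c = Matrix.vecMul c M := fun c => by
    rw [Matrix.toLin'_apply, Matrix.mulVec_transpose]
  have hquad : ∀ c, -(c ⬝ᵥ (M * lorentzMatrix * M.transpose).mulVec c) =
      (∑ i, c i * s i) ^ 2 - ‖∑ i, (c i * s i) • v i‖ ^ 2 := by
    intro c
    rw [hM, dotProduct_gram_mulVec]
    simp only [smul_smul]
    ring
  have hsurj : Function.Surjective (fun c => Matrix.vecMul c M) := by
    intro y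
    refine ⟨Matrix.vecMul y M⁻¹, ?_⟩
    simp [Matrix.vecMul_vecMul, Matrix.nonsing_inv_mul _ (isUnit_iff_ne_zero.2 hdet)]
  have hinj : Function.Injective (fun c => Matrix.vecMul c M) := by
    intro c c' h
    have := congrArg (fun y => Matrix.vecMul y M⁻¹) h
    simpa [Matrix.vecMul_vecMul, Matrix.mul_nonsing_inv _ (isUnit_iff_ne_zero.2 hdet)] using this
  have key : ∀ c, splitTime (Matrix.vecMul c M) ∈
      lorentzCone (convexHull ℝ (Set.range v) ∩ Metric.ball 0 1) ↔
        c ∈ gramCone (M * lorentzMatrix * M.transpose) := by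
    intro c
    have hball : ∀ {t : ℝ} {X : EuclideanSpace ℝ (Fin 3)}, 0 < t →
        (t⁻¹ • X ∈ Metric.ball (0 : EuclideanSpace ℝ (Fin 3)) 1 ↔ 0 < t ^ 2 - ‖X‖ ^ 2) := by
      intro t X ht
      rw [mem_ball_zero_iff, norm_smul, norm_inv, Real.norm_of_nonneg ht.le, inv_mul_lt_iff₀ ht,
        mul_one, sub_pos, sq_lt_sq₀ (norm_nonneg _) ht.le]
    simp only [gramCone, lorentzCone, Set.mem_ofPred_eq, hquad, Set.mem_inter_iff]
    rw [hM, splitTime_vecMul]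
    simp only
    constructor
    · rintro ⟨ht, ⟨hc, hb⟩, hle⟩
      refine ⟨?_, (hball ht).1 hb, hle⟩
      obtain ⟨w, hw0, hw1, hw⟩ := mem_convexHull_range_iff.1 hc
      -- the coordinates of the point in the cone are the rescaled barycentric ones
      have hcw : c = fun i => (∑ j, c j * s j) * w i / s i := by
        apply hinj
        simp only
        set t := ∑ j, c j * s j
        have hsw : ∀ i, t * w i / s i * s i = t * w i := fun i =>
          div_mul_cancel₀ _ (hs i).ne'
        have : splitTime (Matrix.vecMul c M) =
            splitTime (Matrix.vecMul (fun i => t * w i / s i) M) := by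
          rw [hM, splitTime_vecMul, splitTime_vecMul]
          simp only [hsw, mul_smul]
          rw [← Finset.mul_sum, hw1, mul_one, ← Finset.smul_sum, hw, smul_inv_smul₀ ht.ne']
          simp only [← mul_smul]
          rfl
        have h0 := congrArg Prod.fst this
        have h1 := congrArg Prod.snd this
        ext k
        refine Fin.cases h0 (fun k => ?_) k
        exact congrFun (congrArg WithLp.ofLp h1) k
      intro i
      rw [hcw]
      have := hw0 i
      have := hs i
      positivity
    · rintro ⟨h0, hpos, hle⟩
      have hnn : 0 ≤ ∑ i, c i * s i := Finset.sum_nonneg fun i _ => mul_nonneg (h0 i) (hs i).le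
      have ht : 0 < ∑ i, c i * s i := by
        refine hnn.lt_of_ne fun h => ?_
        rw [← h] at hpos
        nlinarith [sq_nonneg ‖∑ i, (c i * s i) • v i‖]
      refine ⟨ht, ⟨mem_convexHull_range_iff.2
        ⟨fun i => (∑ j, c j * s j)⁻¹ * (c i * s i), ?_, ?_, ?_⟩, (hball ht).2 hpos⟩, hle⟩
      · intro i
        have := h0 i
        have := hs i
        positivity
      · rw [← Finset.mul_sum, inv_mul_cancel₀ ht.ne']
      · simp only [mul_smul, Finset.smul_sum]
  ext y
  simp only [Set.mem_preimage, Set.mem_image, hlin]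
  constructor
  · intro hy
    obtain ⟨c, rfl⟩ := hsurj y
    exact ⟨c, (key c).1 hy, rfl⟩
  · rintro ⟨c, hc, rfl⟩
    exact (key c).2 hc

lemma measurableSet_hull_inter_ball (v : Fin 4 → EuclideanSpace ℝ (Fin 3)) :
    MeasurableSet (convexHull ℝ (Set.range v) ∩ Metric.ball 0 1) :=
  (Set.Finite.isCompact_convexHull (𝕜 := ℝ) (Set.finite_range v)).measurableSet.inter
    measurableSet_ball

/-- The hyperbolic volume of the tetrahedron with ideal vertices `vᵢ` depends only on the Gram
matrix of arbitrary positive multiples of the light-like vectors `(1, vᵢ)`. -/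
lemma hyperbolicVolume_eq_of_gram {s : Fin 4 → ℝ} (hs : ∀ i, 0 < s i)
    {v : Fin 4 → EuclideanSpace ℝ (Fin 3)} {K : Matrix (Fin 4) (Fin 4) ℝ}
    (hK : K = spacetimeMatrix s (fun i => s i • v i) * lorentzMatrix *
      (spacetimeMatrix s fun i => s i • v i).transpose) (hdet : K.det ≠ 0) :
    hyperbolicVolume (convexHull ℝ (Set.range v) ∩ Metric.ball 0 1) =
      4 * (ENNReal.ofReal (Real.sqrt (-K.det)) * volume (gramCone K)) := by
  have hS := measurableSet_hull_inter_ball v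
  set M := spacetimeMatrix s fun i => s i • v i with hM
  have hKM : K.det = -M.det ^ 2 := by rw [hK, det_mul_lorentzMatrix_mul_transpose]
  have hMdet : M.det ≠ 0 := by
    intro h
    rw [hKM, h] at hdet
    norm_num at hdet
  rw [hyperbolicVolume_eq_volume_lorentzCone hS Set.inter_subset_right,
    ← measurePreserving_splitTime.measure_preimage
      (measurableSet_lorentzCone hS).nullMeasurableSet,
    preimage_splitTime_lorentzCone hs hM hMdet, Measure.addHaar_image_linearMap,
    LinearMap.det_toLin', Matrix.det_transpose, ← hK, hKM, neg_neg, Real.sqrt_sq_eq_abs]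

/-! ### Determinant, permanent and volume of an ideal tetrahedron -/

/-- Every permutation of the three pairs of opposite edges comes from a renumbering that fixes
`0`. -/
lemma exists_perm_angleMatrix {α β γ α' β' γ' : ℝ}
    (h : (α' = α ∧ β' = β ∧ γ' = γ) ∨ (α' = α ∧ β' = γ ∧ γ' = β) ∨
      (α' = β ∧ β' = α ∧ γ' = γ) ∨ (α' = β ∧ β' = γ ∧ γ' = α) ∨
      (α' = γ ∧ β' = α ∧ γ' = β) ∨ (α' = γ ∧ β' = β ∧ γ' = α)) :
    ∃ σ : Equiv.Perm (Fin 4), ∀ i j,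
      angleMatrix α' β' γ' i j = angleMatrix α β γ (σ i) (σ j) := by
  rcases h with ⟨rfl, rfl, rfl⟩ | ⟨rfl, rfl, rfl⟩ | ⟨rfl, rfl, rfl⟩ | ⟨rfl, rfl, rfl⟩ |
    ⟨rfl, rfl, rfl⟩ | ⟨rfl, rfl, rfl⟩
  · exact ⟨1, fun _ _ => rfl⟩
  -- below, the values of each permutation are listed so that the matrix entries can be read off
  · have h : ∀ i, (Equiv.swap 2 3 : Equiv.Perm (Fin 4)) i = ![0, 1, 3, 2] i := by decide
    exact ⟨Equiv.swap 2 3, fun i j => by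
      rw [h, h]; fin_cases i <;> fin_cases j <;> simp [angleMatrix]⟩
  · have h : ∀ i, (Equiv.swap 1 2 : Equiv.Perm (Fin 4)) i = ![0, 2, 1, 3] i := by decide
    exact ⟨Equiv.swap 1 2, fun i j => by
      rw [h, h]; fin_cases i <;> fin_cases j <;> simp [angleMatrix]⟩
  · have h : ∀ i, (Equiv.swap 1 2 * Equiv.swap 2 3 : Equiv.Perm (Fin 4)) i =
        ![0, 2, 3, 1] i := by decide
    exact ⟨Equiv.swap 1 2 * Equiv.swap 2 3, fun i j => by
      rw [h, h]; fin_cases i <;> fin_cases j <;> simp [angleMatrix]⟩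
  · have h : ∀ i, (Equiv.swap 2 3 * Equiv.swap 1 2 : Equiv.Perm (Fin 4)) i =
        ![0, 3, 1, 2] i := by decide
    exact ⟨Equiv.swap 2 3 * Equiv.swap 1 2, fun i j => by
      rw [h, h]; fin_cases i <;> fin_cases j <;> simp [angleMatrix]⟩
  · have h : ∀ i, (Equiv.swap 1 3 : Equiv.Perm (Fin 4)) i = ![0, 3, 2, 1] i := by decide
    exact ⟨Equiv.swap 1 3, fun i j => by
      rw [h, h]; fin_cases i <;> fin_cases j <;> simp [angleMatrix]⟩

namespace IdealTetrahedron

variable (T : IdealTetrahedron)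

/-- The cosine of the dihedral angle at the edges `01` and `23`. -/
noncomputable def cosA : ℝ := cosRule T.sideA T.sideB T.sideC

/-- The cosine of the dihedral angle at the edges `02` and `13`. -/
noncomputable def cosB : ℝ := cosRule T.sideB T.sideC T.sideA

/-- The cosine of the dihedral angle at the edges `03` and `12`. -/
noncomputable def cosC : ℝ := cosRule T.sideC T.sideA T.sideB

lemma heron_pos_rotate : 0 < heron T.sideB T.sideC T.sideA := by
  rw [heron_rotate]; exact T.heron_pos

lemma heron_pos_rotate_rotate : 0 < heron T.sideC T.sideA T.sideB := by
  rw [heron_rotate]; exact T.heron_pos_rotate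

lemma isTriangleCosines : IsTriangleCosines T.cosA T.cosB T.cosC :=
  isTriangleCosines_cosRule T.sideA_pos T.sideB_pos T.sideC_pos T.heron_pos

lemma cos_arccos_cosA : Real.cos (Real.arccos T.cosA) = T.cosA :=
  cos_arccos_cosRule T.sideB_pos T.sideC_pos T.heron_pos

lemma cos_arccos_cosB : Real.cos (Real.arccos T.cosB) = T.cosB :=
  cos_arccos_cosRule T.sideC_pos T.sideA_pos T.heron_pos_rotate

lemma cos_arccos_cosC : Real.cos (Real.arccos T.cosC) = T.cosC :=
  cos_arccos_cosRule T.sideA_pos T.sideB_pos T.heron_pos_rotate_rotate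

lemma dihedralAngle_eq_angleMatrix (i j : Fin 4) :
    T.dihedralAngle i j =
      angleMatrix (Real.arccos T.cosA) (Real.arccos T.cosB) (Real.arccos T.cosC) i j :=
  T.dihedralAngle_eq i j

lemma dihedralAngle_zero_one : T.dihedralAngle 0 1 = Real.arccos T.cosA :=
  T.dihedralAngle_eq_angleMatrix 0 1

lemma dihedralAngle_zero_two : T.dihedralAngle 0 2 = Real.arccos T.cosB :=
  T.dihedralAngle_eq_angleMatrix 0 2

lemma dihedralAngle_zero_three : T.dihedralAngle 0 3 = Real.arccos T.cosC :=
  T.dihedralAngle_eq_angleMatrix 0 3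

lemma gramMatrix_eq : T.gramMatrix = cosineMatrix T.cosA T.cosB T.cosC := by
  ext i j
  simp only [gramMatrix, Matrix.of_apply, dihedralAngle_eq_angleMatrix]
  fin_cases i <;> fin_cases j <;>
    simp [angleMatrix, cosineMatrix, cos_arccos_cosA, cos_arccos_cosB, cos_arccos_cosC]

/-- The third angle of the triangle is the supplement of the sum of the other two. -/
lemma cos_add_eq_neg : Real.cos (T.dihedralAngle 0 1 + T.dihedralAngle 0 2) = -T.cosC := by
  have h := T.isTriangleCosines
  have hs : Real.sin (Real.arccos T.cosA) * Real.sin (Real.arccos T.cosB) =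
      T.cosC + T.cosA * T.cosB := by
    rw [Real.sin_arccos, Real.sin_arccos, ← Real.sqrt_mul (by linarith [h.sq_lt₁]),
      ← Real.sqrt_sq h.add_mul_pos₃.le]
    congr 1
    linear_combination -h.relation
  rw [dihedralAngle_zero_one, dihedralAngle_zero_two, Real.cos_add, hs, cos_arccos_cosA,
    cos_arccos_cosB]
  ring

lemma det_gramMatrix : T.gramMatrix.det =
    -4 * Real.sin (T.dihedralAngle 0 1) ^ 2 * Real.sin (T.dihedralAngle 0 2) ^ 2 *
      Real.sin (T.dihedralAngle 0 1 + T.dihedralAngle 0 2) ^ 2 := by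
  rw [gramMatrix_eq, T.isTriangleCosines.det_eq, Real.sin_sq, Real.sin_sq, Real.sin_sq,
    cos_add_eq_neg, dihedralAngle_zero_one, dihedralAngle_zero_two, cos_arccos_cosA,
    cos_arccos_cosB, neg_sq]

lemma IsAcute.cos_pos {T : IdealTetrahedron} (h : T.IsAcute) :
    0 < T.cosA ∧ 0 < T.cosB ∧ 0 < T.cosC := by
  refine ⟨Real.arccos_lt_pi_div_two.1 ?_, Real.arccos_lt_pi_div_two.1 ?_,
    Real.arccos_lt_pi_div_two.1 ?_⟩
  · rw [← dihedralAngle_zero_one]; exact h 0 1 (by decide)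
  · rw [← dihedralAngle_zero_two]; exact h 0 2 (by decide)
  · rw [← dihedralAngle_zero_three]; exact h 0 3 (by decide)

lemma IsObtuse.cos_neg {T : IdealTetrahedron} (h : T.IsObtuse) :
    T.cosA < 0 ∨ T.cosB < 0 ∨ T.cosC < 0 := by
  have key : ∀ {x : ℝ}, Real.pi / 2 < Real.arccos x → x < 0 := fun hx =>
    not_le.1 fun h0 => hx.not_ge (Real.arccos_le_pi_div_two.2 h0)
  obtain ⟨i, j, hij, h⟩ := h
  rw [dihedralAngle_eq_angleMatrix] at h
  fin_cases i <;> fin_cases j <;>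
    first
    | exact absurd rfl hij
    | exact .inl (key h)
    | exact .inr (.inl (key h))
    | exact .inr (.inr (key h))

/-- By the law of sines the light-like vectors can be rescaled so that their Gram matrix consists
of the sines of the dihedral angles, up to sign. The scaling factors are proportional to the
products of the edge lengths of the opposite faces. -/
lemma exists_scaling : ∃ s : Fin 4 → ℝ, (∀ i, 0 < s i) ∧
    ∀ i j, s i * s j * (T.edge i j ^ 2 / 2) = Real.sin (T.dihedralAngle i j) := by
  have hA := T.sideA_pos
  have hB := T.sideB_pos
  have hC := T.sideC_pos
  have hh := T.heron_pos
  have h01 := T.edge_pos (i := 0) (j := 1) (by decide)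
  have h02 := T.edge_pos (i := 0) (j := 2) (by decide)
  have h03 := T.edge_pos (i := 0) (j := 3) (by decide)
  have h12 := T.edge_pos (i := 1) (j := 2) (by decide)
  have h13 := T.edge_pos (i := 1) (j := 3) (by decide)
  have h23 := T.edge_pos (i := 2) (j := 3) (by decide)
  -- the ratio of sine to opposite side, from the law of sines
  set k := Real.sqrt (heron T.sideA T.sideB T.sideC) / (2 * T.sideA * T.sideB * T.sideC) with hk
  have hk0 : 0 < k := div_pos (Real.sqrt_pos.2 hh) (by positivity)
  have sA : Real.sin (Real.arccos T.cosA) = T.sideA * k := sin_arccos_cosRule hA hB hC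
  have sB : Real.sin (Real.arccos T.cosB) = T.sideB * k := by
    rw [cosB, sin_arccos_cosRule hB hC hA, heron_rotate, hk]
    congr 2
    ring
  have sC : Real.sin (Real.arccos T.cosC) = T.sideC * k := by
    rw [cosC, sin_arccos_cosRule hC hA hB, heron_rotate, heron_rotate, hk]
    congr 2
    ring
  set q := Real.sqrt (2 * k / (T.sideA * T.sideB * T.sideC))
  have hq0 : 0 < q := Real.sqrt_pos.2 (by positivity)
  have hq : q ^ 2 * (T.sideA * T.sideB * T.sideC) = 2 * k := by
    rw [Real.sq_sqrt (by positivity)]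
    exact div_mul_cancel₀ _ (by positivity)
  have eA : T.sideA = T.edge 0 1 * T.edge 2 3 := rfl
  have eB : T.sideB = T.edge 0 2 * T.edge 1 3 := rfl
  have eC : T.sideC = T.edge 0 3 * T.edge 1 2 := rfl
  rw [eA, eB, eC] at hq
  rw [eA] at sA
  rw [eB] at sB
  rw [eC] at sC
  refine ⟨![q * (T.edge 1 2 * T.edge 1 3 * T.edge 2 3), q * (T.edge 0 2 * T.edge 0 3 * T.edge 2 3),
    q * (T.edge 0 1 * T.edge 0 3 * T.edge 1 3), q * (T.edge 0 1 * T.edge 0 2 * T.edge 1 2)],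
    ?_, ?_⟩
  · intro i
    fin_cases i <;> simp <;> positivity
  · intro i j
    rw [dihedralAngle_eq_angleMatrix]
    fin_cases i <;> fin_cases j <;>
      simp only [angleMatrix, Matrix.of_apply, Matrix.cons_val', Matrix.cons_val, Fin.zero_eta,
        Fin.mk_one, Fin.reduceFinMk, Matrix.cons_val_zero, Matrix.cons_val_one, T.edge_self,
        T.edge_comm 1 0, T.edge_comm 2 0, T.edge_comm 3 0, T.edge_comm 2 1, T.edge_comm 3 1,
        T.edge_comm 3 2, Real.sin_pi, sA, sB, sC] <;>
      first
      | ring1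
      | linear_combination (T.edge 0 1 * T.edge 2 3 / 2) * hq
      | linear_combination (T.edge 0 2 * T.edge 1 3 / 2) * hq
      | linear_combination (T.edge 0 3 * T.edge 1 2 / 2) * hq

/-- The volume is a function of the sines of the dihedral angles, for any numbering of the
vertices. -/
lemma vol_eq (σ : Equiv.Perm (Fin 4)) {K : Matrix (Fin 4) (Fin 4) ℝ}
    (hK : ∀ i j, K i j = -Real.sin (T.dihedralAngle (σ i) (σ j))) :
    T.vol = 4 * (ENNReal.ofReal (Real.sqrt (-K.det)) * volume (gramCone K)) := by
  obtain ⟨s, hs, hsin⟩ := T.exists_scaling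
  have hK' : K = (Matrix.diagonal s * T.lightGram * Matrix.diagonal s).submatrix σ σ := by
    ext i j
    rw [hK, ← hsin, Matrix.submatrix_apply, Matrix.mul_diagonal, Matrix.diagonal_mul,
      lightGram_apply]
    ring
  have hdet : K.det ≠ 0 := by
    rw [hK', Matrix.det_submatrix_equiv_self, Matrix.det_mul, Matrix.det_mul, Matrix.det_diagonal]
    have : ∏ i, s i ≠ 0 := Finset.prod_ne_zero_iff.2 fun i _ => (hs i).ne'
    exact mul_ne_zero (mul_ne_zero this T.det_lightGram_neg.ne) this
  have hrange : Set.range (T.points ∘ σ) = Set.range T.points := σ.surjective.range_comp _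
  rw [vol, region, ← hrange]
  refine hyperbolicVolume_eq_of_gram (s := s ∘ σ) (fun i => hs _) ?_ hdet
  ext i j
  rw [spacetimeMatrix_mul_lorentzMatrix_mul_transpose, hK, ← hsin, real_inner_smul_left,
    real_inner_smul_right]
  have := T.inner_points_sub_one (σ i) (σ j)
  simp only [Function.comp_apply]
  linear_combination -(s (σ i) * s (σ j)) * this

end IdealTetrahedron

theorem mainTheorem3 :
    (∀ T : IdealTetrahedron,
      T.gramMatrix.det =
        -4 * Real.sin (T.dihedralAngle 0 1) ^ 2 * Real.sin (T.dihedralAngle 0 2) ^ 2 *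
          Real.sin (T.dihedralAngle 0 1 + T.dihedralAngle 0 2) ^ 2) ∧
    (∀ T T' : IdealTetrahedron,
      (T.IsAcute ∧ T'.IsAcute) ∨ (T.IsObtuse ∧ T'.IsObtuse) →
      T.gramMatrix.det = T'.gramMatrix.det →
      T.gramMatrix.permanent = T'.gramMatrix.permanent →
      (∃ σ : Equiv.Perm (Fin 4), ∀ i j,
        T'.dihedralAngle i j = T.dihedralAngle (σ i) (σ j)) ∧
      T.vol = T'.vol) := by
  refine ⟨fun T => T.det_gramMatrix, fun T T' hclass hdet hper => ?_⟩
  rw [T.gramMatrix_eq, T'.gramMatrix_eq] at hdet hper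
  have hcos := T.isTriangleCosines.perm_of_det_eq_of_permanent_eq T'.isTriangleCosines
    (hclass.imp (And.imp (·.cos_pos) (·.cos_pos)) (And.imp (·.cos_neg) (·.cos_neg))) hdet hper
  obtain ⟨σ, hσ⟩ : ∃ σ : Equiv.Perm (Fin 4), ∀ i j,
      T'.dihedralAngle i j = T.dihedralAngle (σ i) (σ j) := by
    simp only [IdealTetrahedron.dihedralAngle_eq_angleMatrix]
    apply exists_perm_angleMatrix
    rcases hcos with ⟨h1, h2, h3⟩ | ⟨h1, h2, h3⟩ | ⟨h1, h2, h3⟩ | ⟨h1, h2, h3⟩ | ⟨h1, h2, h3⟩ |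
      ⟨h1, h2, h3⟩ <;> simp [h1, h2, h3]
  refine ⟨⟨σ, hσ⟩, ?_⟩
  let K : Matrix (Fin 4) (Fin 4) ℝ := Matrix.of fun i j => -Real.sin (T'.dihedralAngle i j)
  rw [T.vol_eq σ (K := K) fun i j => by simp [K, hσ], T'.vol_eq 1 (K := K) fun _ _ => rfl]
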